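/- All systems are finite-dimensional spaces $\mathbb C^d$ with computational basis $|1\rangle,\dots,|d\rangle$, and states are positive semidefinite operators, not necessarily normalized; $\mathcal R(\rho)$ is the range of $\rho$. A bipartite state is separable if it is a finite sum of pure product states $|u,v\rangle\langle u,v|$, and entangled otherwise. A state of systems $A,B,C$ is biseparable if it is a finite sum of pure states each of which is a product over one of the bipartitions $A|BC$, $B|AC$, $C|AB$, and genuinely entangled (GE) otherwise. A state $\rho$ can be locally projected onto $\sigma$ if $(P\otimes Q)\rho(P^\dagger\otimes Q^\dagger)=\sigma$ for some operators $P,Q$. For states $\alpha_{AC_1}$ and $\beta_{BC_2}$ we regard $\alpha_{AC_1}\otimes\beta_{BC_2}$ as a tripartite state of $A$, $B$ and $C=C_1C_2$. **Theorem 1.** Let $\alpha_{AC_1}$ and $\beta_{BC_2}$ be bipartite entangled states. Then $\alpha_{AC_1}\otimes\beta_{BC_2}$ is genuinely entangled if one of the following holds. (i) Both $\alpha$ and $\beta$ can be locally projected onto entangled states of rank one or two. (ii) $\mathcal R(\alpha)$ and $\mathcal R(\beta)$ are contained in the (entanglement-breaking) spaces spanned by $\{|a_1,1\rangle,\dots,|a_n,n\rangle\}\subset\mathcal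 H_{AC_1}$ and $\{|b_1,1\rangle,\dots,|b_m,m\rangle\}\subset\mathcal H_{BC_2}$ respectively, for some vectors $a_i,b_j$. (iii) Moreover, let $V$ be a space spanned by $\{|a_1,1\rangle,\dots,|a_n,n\rangle\}\subset\mathcal H_{AC_1}$ that contains the range of some entangled state. Then the following are equivalent: (a) for all entangled $\alpha$ with $\mathcal R(\alpha)\subseteq V$ and all bipartite entangled $\beta$ (in all dimensions), $\alpha_{AC_1}\otimes\beta_{BC_2}$ is GE; (b) for all entangled states $\gamma$ (in all dimensions) with range exactly $\mathrm{span}\{|1,1\rangle,|2,2\rangle\}$ and all bipartite entangled $\beta$, $\gamma_{AC_1}\otimes\beta_{BC_2}$ is GE. The equivalence of (a) and (b) also holds for each single fixed entangled $\beta$ in place of "all $\beta$". -/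

import Mathlib

open scoped Kronecker ComplexOrder

namespace GEState

noncomputable section

/-! Systems are the spaces `ℂ^d`; kets on a system with finite index set `X` are functions `X → ℂ`,
a composite system has the product index set, and (unnormalised) states are positive semidefinite
matrices. -/

/-- The ket `|u⟩ ⊗ |v⟩`, also written `|u, v⟩`. -/
def tensorKet {X Y : Type*} (u : X → ℂ) (v : Y → ℂ) : X × Y → ℂ :=
  fun p => u p.1 * v p.2

/-- The unnormalised pure state `|ψ⟩⟨ψ|`. -/
def proj {X : Type*} (ψ : X → ℂ) : Matrix X X ℂ :=
  Matrix.vecMulVec ψ (star ψ)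

/-- The computational basis ket `|i⟩`. -/
def basisKet {X : Type*} [DecidableEq X] (i : X) : X → ℂ :=
  Pi.single i 1

/-- The range of a state, i.e. the image of its matrix. -/
def stateRange {X : Type*} [Fintype X] (ρ : Matrix X X ℂ) : Submodule ℂ (X → ℂ) :=
  LinearMap.range ρ.mulVecLin

/-- A bipartite operator is separable: it is a finite sum of pure product states
(the weights are absorbed in the unnormalised kets). -/
def IsSeparable {X Y : Type*} (ρ : Matrix (X × Y) (X × Y) ℂ) : Prop :=
  ∃ (n : ℕ) (u : Fin n → X → ℂ) (v : Fin n → Y → ℂ), ρ = ∑ k, proj (tensorKet (u k) (v k))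

/-- A bipartite entangled state: a bipartite state that is not separable. -/
def IsEntangled {X Y : Type*} (ρ : Matrix (X × Y) (X × Y) ℂ) : Prop :=
  ρ.PosSemidef ∧ ¬ IsSeparable ρ

/-- A tripartite ket is a product ket with respect to one of the bipartitions
`A|BC`, `B|AC`, `C|AB`. -/
def IsBiproductKet {A B C : Type*} (ψ : A × B × C → ℂ) : Prop :=
  (∃ (u : A → ℂ) (v : B × C → ℂ), ∀ x y z, ψ (x, y, z) = u x * v (y, z)) ∨
  (∃ (u : B → ℂ) (v : A × C → ℂ), ∀ x y z, ψ (x, y, z) = u y * v (x, z)) ∨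
  (∃ (u : C → ℂ) (v : A × B → ℂ), ∀ x y z, ψ (x, y, z) = u z * v (x, y))

/-- A tripartite operator is biseparable: it is a finite sum of pure states each of which is a
product over some bipartition (which may vary with the summand). -/
def IsBiseparable {A B C : Type*} (ρ : Matrix (A × B × C) (A × B × C) ℂ) : Prop :=
  ∃ (n : ℕ) (ψ : Fin n → A × B × C → ℂ), (∀ k, IsBiproductKet (ψ k)) ∧ ρ = ∑ k, proj (ψ k)

/-- A genuinely entangled tripartite state: a tripartite state that is not biseparable. -/
def IsGenuinelyEntangled {A B C : Type*} (ρ : Matrix (A × B × C) (A × B × C) ℂ) : Prop :=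
  ρ.PosSemidef ∧ ¬ IsBiseparable ρ

/-- The tensor product of a state of `A C₁` and a state of `B C₂`, as a tripartite state of
`A`, `B` and `C = C₁ C₂`. -/
def tripartiteTensor {A B C₁ C₂ : Type*} (α : Matrix (A × C₁) (A × C₁) ℂ)
    (β : Matrix (B × C₂) (B × C₂) ℂ) : Matrix (A × B × (C₁ × C₂)) (A × B × (C₁ × C₂)) ℂ :=
  (α ⊗ₖ β).submatrix
    (fun x => ((x.1, x.2.2.1), (x.2.1, x.2.2.2))) (fun x => ((x.1, x.2.2.1), (x.2.1, x.2.2.2)))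

/-- `ρ` can be locally projected onto (is locally convertible to) `σ`:
`(P ⊗ Q) ρ (P† ⊗ Q†) = σ` for some local operator `P ⊗ Q`. -/
def LocallyProjectsOnto {X Y X' Y' : Type*} [Fintype X] [Fintype Y]
    (ρ : Matrix (X × Y) (X × Y) ℂ) (σ : Matrix (X' × Y') (X' × Y') ℂ) : Prop :=
  ∃ (P : Matrix X' X ℂ) (Q : Matrix Y' Y ℂ),
    (P ⊗ₖ Q) * ρ * (P.conjTranspose ⊗ₖ Q.conjTranspose) = σ

/-- `ρ` can be locally projected onto an entangled state of rank one or two. -/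
def ProjectsOntoRankLETwo {X Y : Type*} [Fintype X] [Fintype Y]
    (ρ : Matrix (X × Y) (X × Y) ℂ) : Prop :=
  ∃ (m n : ℕ) (σ : Matrix (Fin m × Fin n) (Fin m × Fin n) ℂ),
    LocallyProjectsOnto ρ σ ∧ IsEntangled σ ∧ (σ.rank = 1 ∨ σ.rank = 2)

/-- The space spanned by the kets `|a_i, i⟩`. The index `i` runs over all basis labels of the second
system and the `a i` are arbitrary; a shorter list of vectors is obtained with `a i = 0` for the
labels that do not occur. -/
def ebSpace {X Y : Type*} [DecidableEq Y] (a : Y → X → ℂ) : Submodule ℂ (X × Y → ℂ) :=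
  Submodule.span ℂ (Set.range fun i => tensorKet (a i) (basisKet i))

/-- `V ⊆ ℋ_X ⊗ ℋ_Y` is entanglement-breaking: for each ket `ψ ∈ V ⊗ ℋ_Z` (that is, each ket all of
whose `Z`-components lie in `V`), tracing out `Y` leaves a separable state of `X` and `Z`. -/
def IsEBSpace {X Y : Type*} [Fintype Y] (V : Submodule ℂ (X × Y → ℂ)) : Prop :=
  ∀ (d : ℕ) (ψ : (X × Y) × Fin d → ℂ), (∀ z, (fun p => ψ (p, z)) ∈ V) →
    IsSeparable (Matrix.of fun r s : X × Fin d =>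
      ∑ y, ψ ((r.1, y), r.2) * star (ψ ((s.1, y), s.2)))

/-- The spaces spanned by kets `|a_i, i⟩` are indeed entanglement-breaking. -/
theorem isEBSpace_ebSpace {X Y : Type*} [Fintype Y] [DecidableEq Y] (a : Y → X → ℂ) :
    IsEBSpace (ebSpace a) := by
  intro d ψ hψ
  have key : ∀ f ∈ ebSpace a, ∃ c : Y → ℂ, ∀ x y, f (x, y) = a y x * c y := by
    intro f hf
    refine Submodule.span_induction ?_ ?_ ?_ ?_ hf
    · rintro _ ⟨i, rfl⟩
      refine ⟨basisKet i, fun x y => ?_⟩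
      by_cases h : y = i
      · subst h; rfl
      · simp [tensorKet, basisKet, h]
    · exact ⟨0, by simp⟩
    · rintro f g - - ⟨c, hc⟩ ⟨e, he⟩
      exact ⟨c + e, fun x y => by simp [hc, he, mul_add]⟩
    · rintro t f - ⟨c, hc⟩
      exact ⟨t • c, fun x y => by simp [hc]; ring⟩
  choose c hc using fun z => key _ (hψ z)
  let e := (Fintype.equivFin Y).symm
  refine ⟨Fintype.card Y, fun k => a (e k), fun k z => c z (e k), ?_⟩
  ext ⟨x, z⟩ ⟨x', z'⟩
  simp only [Matrix.of_apply, Matrix.sum_apply, proj, Matrix.vecMulVec_apply, tensorKet,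
    Pi.star_apply]
  rw [← e.sum_comp]
  exact Finset.sum_congr rfl fun k _ => by rw [← hc, ← hc]

/-- The simplest space of this kind, spanned by `|1, 1⟩` and `|2, 2⟩`, in `ℂ^(m+2) ⊗ ℂ^(n+2)`
(the basis labels `1, 2` are `0, 1` in `Fin`). -/
def twoKetSpace (m n : ℕ) : Submodule ℂ (Fin (m + 2) × Fin (n + 2) → ℂ) :=
  Submodule.span ℂ {tensorKet (basisKet 0) (basisKet 0), tensorKet (basisKet 1) (basisKet 1)}

end

end GEState

/-! Call a pair of functionals `f`, `g` a witness for `ρ` if `f ρ g* ≠ 0` while `f` or `g` vanishes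
on each product ket in the range of `ρ`. In any decomposition of `ρ` into pure states, the kets `w
k` lie in the range and `f ρ g* = ∑ (f·w k) conj (g·w k)`, so a state with a witness is entangled.

Witnesses multiply: `f ⊗ f'` and `g ⊗ g'` rule out biseparability of `α ⊗ β`
(`HasWitness.not_isBiseparable`). Contracting a biproduct ket in the range of `α ⊗ β` with suitable
functionals on one side leaves a product ket in the range of the other state. There `f` or `g`
vanishes, and since a vector space is not the union of two proper subspaces, the same one of them
vanishes for all these contractions.

For (i) and (ii) it remains to find witnesses. They pull back along local operators and exist for
entangled states of rank at most two, and every entangled state in `ebSpace a` projects onto a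
two-qubit state in `span {|1,1⟩, |2,2⟩}` with a nonzero off-diagonal entry. For (iii) `β` may lack a
witness; biseparability is instead transported by local operators between `ebSpace a` and
`twoKetSpace`. The projected state has the full span as its range, or no nonzero product ket in its
range; `not_isBiseparable_of_no_product` settles the latter case for every entangled `β`. -/

namespace GEState

open Matrix

/-! ### Pure-state decompositions and ranges -/

section Decomposition

variable {X ι : Type*} [Fintype X] [Fintype ι]

theorem proj_mulVec (ψ w : X → ℂ) : proj ψ *ᵥ w = (star ψ ⬝ᵥ w) • ψ := by
  ext x
  simp only [proj, Matrix.mulVec, dotProduct, vecMulVec_apply, Pi.smul_apply, smul_eq_mul,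
    Finset.sum_mul]
  exact Finset.sum_congr rfl fun _ _ => by ring

/-- Every state is a finite sum of pure states. -/
theorem exists_sum_proj {ρ : Matrix X X ℂ} (h : ρ.PosSemidef) :
    ∃ v : X → X → ℂ, ρ = ∑ k, proj (v k) := by
  classical
  obtain ⟨B, rfl⟩ : ∃ B : Matrix X X ℂ, ρ = Bᴴ * B := by
    open scoped MatrixOrder in
    have := CStarAlgebra.nonneg_iff_eq_star_mul_self.mp (Matrix.nonneg_iff_posSemidef.mpr h)
    exact this
  refine ⟨fun k x => star (B k x), ?_⟩
  ext x y
  simp [Matrix.mul_apply, Matrix.sum_apply, proj, vecMulVec_apply]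

/-- The left side sees only the state, the right side any chosen decomposition; every witness
argument compares the two. For `f = g` the right side is a sum of squared moduli. -/
theorem dotProduct_sum_proj_mulVec (v : ι → X → ℂ) (f g : X → ℂ) :
    f ⬝ᵥ ((∑ k, proj (v k)) *ᵥ star g) = ∑ k, (f ⬝ᵥ v k) * star (g ⬝ᵥ v k) := by
  rw [Matrix.sum_mulVec, dotProduct_sum]
  refine Finset.sum_congr rfl fun k _ => ?_
  rw [proj_mulVec, dotProduct_smul, smul_eq_mul, mul_comm, Matrix.star_dotProduct_star,
    dotProduct_comm g]

/-- A vector outside a subspace of `ℂ^X` is detected by a functional vanishing on the subspace. -/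
theorem exists_dotProduct_ne_zero {W : Submodule ℂ (X → ℂ)} {x : X → ℂ} (hx : x ∉ W) :
    ∃ f : X → ℂ, f ⬝ᵥ x ≠ 0 ∧ ∀ w ∈ W, f ⬝ᵥ w = 0 := by
  classical
  obtain ⟨φ, h1, h2⟩ := Submodule.exists_le_ker_of_notMem hx
  refine ⟨(dotProductEquiv ℂ X).symm φ, ?_, fun w hw => ?_⟩
  · rwa [← dotProductEquiv_apply_apply, LinearEquiv.apply_symm_apply]
  · rw [← dotProductEquiv_apply_apply, LinearEquiv.apply_symm_apply]
    exact h2 hw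

theorem exists_dual_pair {x y : X → ℂ} (h : LinearIndependent ℂ ![x, y]) :
    ∃ f : X → ℂ, f ⬝ᵥ x = 1 ∧ f ⬝ᵥ y = 0 := by
  have hx : x ∉ Submodule.span ℂ {y} := by
    rw [Submodule.mem_span_singleton]
    rintro ⟨t, rfl⟩
    have := LinearIndependent.pair_iff.mp h 1 (-t) (by simp)
    exact one_ne_zero this.1
  obtain ⟨f, h1, h2⟩ := exists_dotProduct_ne_zero hx
  refine ⟨(f ⬝ᵥ x)⁻¹ • f, ?_, ?_⟩
  · rw [smul_dotProduct, smul_eq_mul, inv_mul_cancel₀ h1]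
  · rw [smul_dotProduct, h2 y (Submodule.mem_span_singleton_self y), smul_zero]

theorem sum_mul_star_self_eq_zero {z : ι → ℂ} (h : ∑ k, z k * star (z k) = 0) (k : ι) :
    z k = 0 := by
  have h0 : ∀ i ∈ Finset.univ, 0 ≤ z i * star (z i) := fun i _ => mul_star_self_nonneg (z i)
  simpa using (Finset.sum_eq_zero_iff_of_nonneg h0).mp h k (Finset.mem_univ k)

/-- The range of a sum of pure states is the span of their kets. -/
theorem stateRange_sum_proj (v : ι → X → ℂ) :
    stateRange (∑ k, proj (v k)) = Submodule.span ℂ (Set.range v) := by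
  apply le_antisymm
  · rintro _ ⟨w, rfl⟩
    rw [Matrix.mulVecLin_apply, Matrix.sum_mulVec]
    refine Submodule.sum_mem _ fun k _ => ?_
    rw [proj_mulVec]
    exact Submodule.smul_mem _ _ (Submodule.subset_span ⟨k, rfl⟩)
  · rw [Submodule.span_le]
    rintro _ ⟨k, rfl⟩
    by_contra hk
    -- A functional `f` that kills the range gives `∑ |f·v k|² = 0`, hence kills each `v k`.
    obtain ⟨f, h1, h2⟩ := exists_dotProduct_ne_zero hk
    have h3 := h2 _ ⟨star f, rfl⟩
    rw [Matrix.mulVecLin_apply, dotProduct_sum_proj_mulVec] at h3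
    exact h1 (sum_mul_star_self_eq_zero h3 k)

theorem mem_stateRange_sum_proj (v : ι → X → ℂ) (k : ι) :
    v k ∈ stateRange (∑ k, proj (v k)) := by
  rw [stateRange_sum_proj]
  exact Submodule.subset_span ⟨k, rfl⟩

theorem mul_sum_proj_mul {X' : Type*} (K : Matrix X' X ℂ) (v : ι → X → ℂ) :
    K * (∑ k, proj (v k)) * Kᴴ = ∑ k, proj (K *ᵥ v k) := by
  rw [Matrix.mul_sum, Matrix.sum_mul]
  refine Finset.sum_congr rfl fun k _ => ?_
  rw [proj, proj, mul_vecMulVec, vecMulVec_mul, star_mulVec]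

theorem mulVec_mem_stateRange {X' : Type*} [Fintype X'] {ρ : Matrix X X ℂ} (hρ : ρ.PosSemidef)
    (K : Matrix X' X ℂ) {x : X → ℂ} (hx : x ∈ stateRange ρ) :
    K *ᵥ x ∈ stateRange (K * ρ * Kᴴ) := by
  obtain ⟨v, rfl⟩ := exists_sum_proj hρ
  rw [mul_sum_proj_mul, stateRange_sum_proj]
  rw [stateRange_sum_proj] at hx
  have := Submodule.mem_map_of_mem (f := K.mulVecLin) hx
  rw [Submodule.map_span, ← Set.range_comp] at this
  exact this

end Decomposition

/-! ### Product kets and local operators -/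

section Product

variable {X Y : Type*}

theorem isSeparable_sum_proj {ι : Type*} [Fintype ι] (u : ι → X → ℂ) (v : ι → Y → ℂ) :
    IsSeparable (∑ k, proj (tensorKet (u k) (v k))) := by
  let e := (Fintype.equivFin ι).symm
  exact ⟨Fintype.card ι, fun k => u (e k), fun k => v (e k),
    (e.sum_comp fun k => proj (tensorKet (u k) (v k))).symm⟩

theorem isSeparable_of_mem_product {ι : Type*} [Fintype ι] {w : ι → X × Y → ℂ}
    (h : ∀ k, ∃ u v, w k = tensorKet u v) : IsSeparable (∑ k, proj (w k)) := by
  choose u v h using h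
  simp only [h]
  exact isSeparable_sum_proj u v

variable [Fintype X] [Fintype Y]

theorem tensorKet_dotProduct_tensorKet (f : X → ℂ) (g : Y → ℂ) (u : X → ℂ) (v : Y → ℂ) :
    tensorKet f g ⬝ᵥ tensorKet u v = (f ⬝ᵥ u) * (g ⬝ᵥ v) := by
  simp only [dotProduct, tensorKet, Fintype.sum_prod_type, Finset.sum_mul_sum]
  exact Finset.sum_congr rfl fun _ _ => Finset.sum_congr rfl fun _ _ => by ring

theorem kronecker_mulVec_tensorKet {X' Y' : Type*} (P : Matrix X' X ℂ) (Q : Matrix Y' Y ℂ)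
    (u : X → ℂ) (v : Y → ℂ) :
    (P ⊗ₖ Q) *ᵥ tensorKet u v = tensorKet (P *ᵥ u) (Q *ᵥ v) := by
  ext ⟨x, y⟩
  exact tensorKet_dotProduct_tensorKet (fun i => P x i) (fun j => Q y j) u v

theorem IsSeparable.kronecker_conj {X' Y' : Type*} {ρ : Matrix (X × Y) (X × Y) ℂ}
    (h : IsSeparable ρ) (P : Matrix X' X ℂ) (Q : Matrix Y' Y ℂ) :
    IsSeparable ((P ⊗ₖ Q) * ρ * (P ⊗ₖ Q)ᴴ) := by
  obtain ⟨n, u, v, rfl⟩ := h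
  rw [mul_sum_proj_mul]
  simp only [kronecker_mulVec_tensorKet]
  exact isSeparable_sum_proj _ _

end Product

/-! ### Witnesses, and their existence in rank at most two -/

section Witness

variable {X Y : Type*} [Fintype X] [Fintype Y]

/-- `f` and `g` witness the entanglement of `ρ`: on each product ket in the range of `ρ` one of them
vanishes, although `ρ` has a nonzero matrix entry between them. -/
def HasWitness (ρ : Matrix (X × Y) (X × Y) ℂ) : Prop :=
  ∃ f g : X × Y → ℂ, f ⬝ᵥ (ρ *ᵥ star g) ≠ 0 ∧
    ∀ u v, tensorKet u v ∈ stateRange ρ → f ⬝ᵥ tensorKet u v = 0 ∨ g ⬝ᵥ tensorKet u v = 0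

theorem HasWitness.not_isSeparable {ρ : Matrix (X × Y) (X × Y) ℂ} (h : HasWitness ρ) :
    ¬ IsSeparable ρ := by
  rintro ⟨n, u, v, rfl⟩
  obtain ⟨f, g, h1, h2⟩ := h
  refine h1 ?_
  rw [dotProduct_sum_proj_mulVec]
  refine Finset.sum_eq_zero fun k _ => ?_
  rcases h2 _ _ (mem_stateRange_sum_proj _ k) with h | h <;> simp [h]

/-- Local operators map product kets to product kets and the range into the range, so the
functionals can be composed with `P ⊗ Q`. -/
theorem HasWitness.of_kronecker_conj {X' Y' : Type*} [Fintype X'] [Fintype Y']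
    {ρ : Matrix (X × Y) (X × Y) ℂ} (hρ : ρ.PosSemidef) (P : Matrix X' X ℂ) (Q : Matrix Y' Y ℂ)
    (h : HasWitness ((P ⊗ₖ Q) * ρ * (P ⊗ₖ Q)ᴴ)) : HasWitness ρ := by
  obtain ⟨f, g, h1, h2⟩ := h
  refine ⟨f ᵥ* (P ⊗ₖ Q), g ᵥ* (P ⊗ₖ Q), ?_, fun u v huv => ?_⟩
  · rwa [star_vecMul, ← dotProduct_mulVec, mulVec_mulVec, mulVec_mulVec]
  · have := mulVec_mem_stateRange hρ (P ⊗ₖ Q) huv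
    rw [kronecker_mulVec_tensorKet] at this
    rw [← dotProduct_mulVec, ← dotProduct_mulVec, kronecker_mulVec_tensorKet]
    exact h2 _ _ this

/-- A state with no nonzero product ket in its range has a witness. -/
theorem HasWitness.of_no_product {ρ : Matrix (X × Y) (X × Y) ℂ} (hρ : IsEntangled ρ)
    (h : ∀ u v, tensorKet u v ∈ stateRange ρ → tensorKet u v = 0) : HasWitness ρ := by
  obtain ⟨hp, hs⟩ := hρ
  obtain ⟨w, rfl⟩ := exists_sum_proj hp
  by_contra hc
  refine hs ?_
  have hw : ∀ k, w k = 0 := by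
    intro k
    by_contra hk
    obtain ⟨f, h1, -⟩ := exists_dotProduct_ne_zero (W := ⊥) (mt (Submodule.mem_bot ℂ).mp hk)
    -- With `f = g` the required entry is a sum of squares, nonzero as soon as `f` detects one ket.
    refine hc ⟨f, f, fun h3 => ?_, fun u v huv => Or.inl (by rw [h u v huv, dotProduct_zero])⟩
    rw [dotProduct_sum_proj_mulVec] at h3
    exact h1 (sum_mul_star_self_eq_zero h3 k)
  have : (∑ k, proj (w k)) = ∑ k : Empty, proj (tensorKet (k.elim : X → ℂ) (k.elim : Y → ℂ)) := by
    simp [hw, proj]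
  rw [this]
  exact isSeparable_sum_proj _ _

/-- If the product kets in the range are all proportional to one ket, an entangled state has a
witness. -/
theorem HasWitness.of_product_mem_span {ρ : Matrix (X × Y) (X × Y) ℂ} (hρ : IsEntangled ρ)
    (a : X → ℂ) (b : Y → ℂ)
    (h : ∀ u v, tensorKet u v ∈ stateRange ρ → tensorKet u v ∈ Submodule.span ℂ {tensorKet a b}) :
    HasWitness ρ := by
  obtain ⟨hp, hs⟩ := hρ
  obtain ⟨w, rfl⟩ := exists_sum_proj hp
  by_contra hc
  refine hs (isSeparable_of_mem_product fun k => ?_)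
  have hk : w k ∈ Submodule.span ℂ {tensorKet a b} := by
    by_contra hk
    obtain ⟨f, h1, h2⟩ := exists_dotProduct_ne_zero hk
    refine hc ⟨f, f, fun h3 => ?_, fun u v huv => Or.inl (h2 _ (h u v huv))⟩
    rw [dotProduct_sum_proj_mulVec] at h3
    exact h1 (sum_mul_star_self_eq_zero h3 k)
  obtain ⟨t, ht⟩ := Submodule.mem_span_singleton.mp hk
  exact ⟨t • a, b, by rw [← ht]; ext; simp [tensorKet, mul_assoc]⟩

theorem mul_eq_zero_of_add_product {a a' : X → ℂ} {b b' : Y → ℂ}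
    (ha : LinearIndependent ℂ ![a, a']) (hb : LinearIndependent ℂ ![b, b']) {s t : ℂ}
    {u : X → ℂ} {v : Y → ℂ} (h : s • tensorKet a b + t • tensorKet a' b' = tensorKet u v) :
    s = 0 ∨ t = 0 := by
  obtain ⟨φ, h1, h2⟩ := exists_dual_pair ha
  obtain ⟨φ', h3, h4⟩ := exists_dual_pair (LinearIndependent.pair_symm_iff.mp ha)
  obtain ⟨χ, h5, h6⟩ := exists_dual_pair hb
  obtain ⟨χ', h7, h8⟩ := exists_dual_pair (LinearIndependent.pair_symm_iff.mp hb)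
  have key : ∀ p q, s * ((p ⬝ᵥ a) * (q ⬝ᵥ b)) + t * ((p ⬝ᵥ a') * (q ⬝ᵥ b')) =
      (p ⬝ᵥ u) * (q ⬝ᵥ v) := by
    intro p q
    rw [← tensorKet_dotProduct_tensorKet p q u v, ← h, dotProduct_add, dotProduct_smul,
      dotProduct_smul, tensorKet_dotProduct_tensorKet, tensorKet_dotProduct_tensorKet]
    rfl
  have k1 := key φ χ
  have k2 := key φ' χ'
  have k3 := key φ χ'
  have k4 := key φ' χ
  simp only [h1, h2, h3, h4, h5, h6, h7, h8] at k1 k2 k3 k4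
  -- In the dual bases the ket has the coefficient matrix `diag(s, t)`, whose determinant vanishes
  -- because a product ket has rank at most one.
  have : s * t = 0 := by linear_combination k1 * (t : ℂ) + (φ ⬝ᵥ u) * (χ ⬝ᵥ v) * k2 -
    (φ' ⬝ᵥ u) * (χ ⬝ᵥ v) * k3
  exact mul_eq_zero.mp this

/-- The product kets in the span of `|a, b⟩` and `|a', b'⟩` are multiples of these two, so that a
state which is not diagonal in them has a witness. -/
theorem HasWitness.of_dual_pair {ρ : Matrix (X × Y) (X × Y) ℂ}
    {a a' : X → ℂ} {b b' : Y → ℂ}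
    (hρ : stateRange ρ ≤ Submodule.span ℂ {tensorKet a b, tensorKet a' b'})
    (ha : LinearIndependent ℂ ![a, a']) (hb : LinearIndependent ℂ ![b, b'])
    {f g : X × Y → ℂ} (h1 : f ⬝ᵥ tensorKet a' b' = 0) (h2 : g ⬝ᵥ tensorKet a b = 0)
    (h : f ⬝ᵥ (ρ *ᵥ star g) ≠ 0) : HasWitness ρ := by
  refine ⟨f, g, h, fun u v huv => ?_⟩
  obtain ⟨s, t, hst⟩ := Submodule.mem_span_pair.mp (hρ huv)
  rw [← hst]
  rcases mul_eq_zero_of_add_product ha hb hst with rfl | rfl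
  · left; simp [h1]
  · right; simp [h2]

theorem exists_smul_of_not_linearIndependent {V : Type*} [AddCommGroup V] [Module ℂ V] {x y : V}
    (hx : x ≠ 0) (h : ¬ LinearIndependent ℂ ![x, y]) : ∃ t : ℂ, t • x = y := by
  rw [LinearIndependent.pair_iff' hx] at h
  push Not at h
  exact h

/-- An entangled state of rank at most two has a witness. -/
theorem HasWitness.of_rank_le_two {ρ : Matrix (X × Y) (X × Y) ℂ} (hρ : IsEntangled ρ)
    (hr : ρ.rank ≤ 2) : HasWitness ρ := by
  by_cases h0 : ∀ u v, tensorKet u v ∈ stateRange ρ → tensorKet u v = 0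
  · exact .of_no_product hρ h0
  push Not at h0
  obtain ⟨a, b, hab, hab0⟩ := h0
  by_cases h1 : ∀ u v, tensorKet u v ∈ stateRange ρ →
      tensorKet u v ∈ Submodule.span ℂ {tensorKet a b}
  · exact .of_product_mem_span hρ a b h1
  push Not at h1
  obtain ⟨a', b', hab', hn⟩ := h1
  have hli : LinearIndependent ℂ ![tensorKet a b, tensorKet a' b'] := by
    rw [LinearIndependent.pair_iff' hab0]
    intro t ht
    exact hn (ht ▸ Submodule.smul_mem _ _ (Submodule.mem_span_singleton_self _))
  have hspan : Submodule.span ℂ {tensorKet a b, tensorKet a' b'} = stateRange ρ := by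
    refine Submodule.eq_of_le_of_finrank_le ?_ ?_
    · rw [Submodule.span_le]
      rintro _ (rfl | rfl) <;> assumption
    · have := finrank_span_eq_card hli
      rw [Matrix.range_cons_cons_empty] at this
      rw [this]
      exact hr
  obtain ⟨hp, hs⟩ := hρ
  obtain ⟨w, rfl⟩ := exists_sum_proj hp
  have hw : ∀ k, ∃ s t : ℂ, s • tensorKet a b + t • tensorKet a' b' = w k := fun k =>
    Submodule.mem_span_pair.mp (hspan ▸ mem_stateRange_sum_proj w k)
  have ha0 : a ≠ 0 := by rintro rfl; exact hab0 (by ext; simp [tensorKet])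
  have hb0 : b ≠ 0 := by rintro rfl; exact hab0 (by ext; simp [tensorKet])
  -- If the kets are parallel on one side, every ket in the range is a product and the state is
  -- separable.
  by_cases ha : LinearIndependent ℂ ![a, a']
  swap
  · obtain ⟨r, rfl⟩ := exists_smul_of_not_linearIndependent ha0 ha
    refine absurd (isSeparable_of_mem_product fun k => ?_) hs
    obtain ⟨s, t, h⟩ := hw k
    refine ⟨a, s • b + (t * r) • b', ?_⟩
    rw [← h]
    ext
    simp [tensorKet]
    ring
  by_cases hb : LinearIndependent ℂ ![b, b']
  swap
  · obtain ⟨r, rfl⟩ := exists_smul_of_not_linearIndependent hb0 hb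
    refine absurd (isSeparable_of_mem_product fun k => ?_) hs
    obtain ⟨s, t, h⟩ := hw k
    refine ⟨s • a + (t * r) • a', b, ?_⟩
    rw [← h]
    ext
    simp [tensorKet]
    ring
  -- `f` and `g` read off the two coordinates of a ket in the range, so `f ρ g*` is the coherence `∑
  -- s k * star (t k)`. If it vanishes, `ρ` is diagonal in the two product kets.
  obtain ⟨f, f1, f2⟩ := exists_dual_pair hli
  obtain ⟨g, g1, g2⟩ := exists_dual_pair (LinearIndependent.pair_symm_iff.mp hli)
  refine .of_dual_pair hspan.ge ha hb f2 g2 fun h => hs ?_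
  choose s t hst using hw
  rw [dotProduct_sum_proj_mulVec] at h
  simp only [← hst, dotProduct_add, dotProduct_smul, f1, f2, g1, g2, smul_eq_mul, mul_one,
    mul_zero, add_zero, zero_add] at h
  have h' : ∑ k, t k * star (s k) = 0 := by
    have := congrArg star h
    simpa [mul_comm] using this
  have : ∑ k, proj (w k) = ∑ k : (X × Y) ⊕ (X × Y), proj (tensorKet
      (Sum.elim (fun k => s k • a) (fun k => t k • a') k) (Sum.elim (fun _ => b) (fun _ => b') k)) := by
    rw [Fintype.sum_sum_type]
    ext ⟨x, y⟩ ⟨x', y'⟩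
    simp only [← hst, Matrix.add_apply, Matrix.sum_apply, proj, vecMulVec_apply, Pi.star_apply,
      Pi.add_apply, Pi.smul_apply, tensorKet, smul_eq_mul, Sum.elim_inl, Sum.elim_inr]
    have e1 : ∑ k, s k * star (t k) * (a x * b y * star (a' x' * b' y')) = 0 := by
      rw [← Finset.sum_mul, h, zero_mul]
    have e2 : ∑ k, t k * star (s k) * (a' x * b' y * star (a x' * b y')) = 0 := by
      rw [← Finset.sum_mul, h', zero_mul]
    rw [← add_zero (_ + _), ← e1, ← add_zero (_ + _), ← e2, ← Finset.sum_add_distrib,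
      ← Finset.sum_add_distrib, ← Finset.sum_add_distrib]
    refine Finset.sum_congr rfl fun k _ => ?_
    simp only [star_add, star_mul']
    ring
  rw [this]
  exact isSeparable_sum_proj _ _

end Witness

/-! ### Partial contractions of kets in the range of a tensor product -/

section Contraction

variable {P Q : Type*} [Fintype P] [Fintype Q]

theorem dotProduct_contraction_comm (c : Q → ℂ) (f : P → ℂ) (ψ : P × Q → ℂ) :
    (c ⬝ᵥ fun q => f ⬝ᵥ fun p => ψ (p, q)) = f ⬝ᵥ fun p => c ⬝ᵥ fun q => ψ (p, q) := by
  simp only [dotProduct, Finset.mul_sum]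
  rw [Finset.sum_comm]
  exact Finset.sum_congr rfl fun _ _ => Finset.sum_congr rfl fun _ _ => by ring

theorem tensorKet_dotProduct (f : P → ℂ) (c : Q → ℂ) (ψ : P × Q → ℂ) :
    tensorKet f c ⬝ᵥ ψ = f ⬝ᵥ fun p => c ⬝ᵥ fun q => ψ (p, q) := by
  simp only [dotProduct, tensorKet, Fintype.sum_prod_type, Finset.mul_sum, mul_assoc]

/-- Contracting `(α ⊗ β) w` with `c` equals `α` applied to the contraction of `w` with `c β`. -/
theorem contraction_mem_left {α : Matrix P P ℂ} {β : Matrix Q Q ℂ} {ψ : P × Q → ℂ}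
    (h : ψ ∈ stateRange (α ⊗ₖ β)) (c : Q → ℂ) :
    (fun p => c ⬝ᵥ fun q => ψ (p, q)) ∈ stateRange α := by
  obtain ⟨w, rfl⟩ := h
  refine ⟨fun p => (c ᵥ* β) ⬝ᵥ fun q => w (p, q), ?_⟩
  ext p
  have h1 : ∀ q, (α ⊗ₖ β).mulVecLin w (p, q) =
      (fun p' => α p p') ⬝ᵥ fun p' => (fun q' => β q q') ⬝ᵥ fun q' => w (p', q') :=
    fun q => tensorKet_dotProduct (fun p' => α p p') (fun q' => β q q') w
  simp only [h1, Matrix.mulVecLin_apply]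
  rw [dotProduct_contraction_comm c (fun p' => α p p')
    (fun r => (fun q' => β r.2 q') ⬝ᵥ fun q' => w (r.1, q'))]
  simp only [← dotProduct_mulVec]
  rfl

theorem contraction_mem_right {α : Matrix P P ℂ} {β : Matrix Q Q ℂ} {ψ : P × Q → ℂ}
    (h : ψ ∈ stateRange (α ⊗ₖ β)) (f : P → ℂ) :
    (fun q => f ⬝ᵥ fun p => ψ (p, q)) ∈ stateRange β := by
  obtain ⟨w, rfl⟩ := h
  refine ⟨fun q => (f ᵥ* α) ⬝ᵥ fun p => w (p, q), ?_⟩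
  ext q
  have h1 : ∀ p, (α ⊗ₖ β).mulVecLin w (p, q) =
      (fun q' => β q q') ⬝ᵥ fun q' => (fun p' => α p p') ⬝ᵥ fun p' => w (p', q') := fun p => by
    rw [dotProduct_contraction_comm]
    exact tensorKet_dotProduct (fun p' => α p p') (fun q' => β q q') w
  simp only [h1, Matrix.mulVecLin_apply]
  rw [← dotProduct_contraction_comm (fun q' => β q q') f
    (fun r => (fun p' => α r.1 p') ⬝ᵥ fun p' => w (p', r.2))]
  simp only [← dotProduct_mulVec]
  rfl

end Contraction

/-! ### A vector space is not the union of two proper subspaces -/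

section Union

theorem eq_zero_or_eq_zero_of_forall {V W W' : Type*} [AddCommGroup V] [Module ℂ V]
    [AddCommGroup W] [Module ℂ W] [AddCommGroup W'] [Module ℂ W'] (F : V →ₗ[ℂ] W)
    (G : V →ₗ[ℂ] W') (h : ∀ x, F x = 0 ∨ G x = 0) : F = 0 ∨ G = 0 := by
  by_contra! hc
  obtain ⟨x, hx⟩ : ∃ x, F x ≠ 0 := by
    by_contra! h'
    exact hc.1 (LinearMap.ext h')
  obtain ⟨y, hy⟩ : ∃ y, G y ≠ 0 := by
    by_contra! h'
    exact hc.2 (LinearMap.ext h')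
  have h1 := (h x).resolve_left hx
  have h2 := (h y).resolve_right hy
  rcases h (x + y) with h3 | h3
  · rw [map_add, h2, add_zero] at h3
    exact hx h3
  · rw [map_add, h1, zero_add] at h3
    exact hy h3

variable {X Y : Type*} [Fintype X] [Fintype Y]

theorem eq_zero_or_eq_zero_of_forall_dotProduct {x y : X → ℂ}
    (h : ∀ c, c ⬝ᵥ x = 0 ∨ c ⬝ᵥ y = 0) : x = 0 ∨ y = 0 := by
  classical
  refine (eq_zero_or_eq_zero_of_forall (dotProductEquiv ℂ X x) (dotProductEquiv ℂ X y)
    fun c => ?_).imp (fun h => ?_) fun h => ?_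
  · simpa [dotProduct_comm] using h c
  · simpa using h
  · simpa using h

/-- Product functionals do not form a subspace, so the union argument is applied in `s` for fixed
`t`, and again in `t`. -/
theorem eq_zero_or_eq_zero_of_forall_tensorKet {x y : X × Y → ℂ}
    (h : ∀ s t, tensorKet s t ⬝ᵥ x = 0 ∨ tensorKet s t ⬝ᵥ y = 0) : x = 0 ∨ y = 0 := by
  classical
  let M (z : X × Y → ℂ) : Matrix X Y ℂ := Matrix.of fun a b => z (a, b)
  have hM : ∀ z s t, tensorKet s t ⬝ᵥ z = s ⬝ᵥ (M z *ᵥ t) := by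
    intro z s t
    rw [tensorKet_dotProduct]
    simp only [dotProduct_comm t]
    rfl
  have key : ∀ z, (M z).mulVecLin = 0 → z = 0 := by
    intro z hz
    ext ⟨a, b⟩
    have := congrFun (LinearMap.congr_fun hz (Pi.single b 1)) a
    simpa [M] using this
  refine (eq_zero_or_eq_zero_of_forall (M x).mulVecLin (M y).mulVecLin fun t => ?_).imp
    (key x) (key y)
  exact eq_zero_or_eq_zero_of_forall_dotProduct fun s => by
    have := h s t
    rwa [hM, hM] at this

end Union

/-! ### Biseparability of `α ⊗ β` -/

section Tripartite

variable {A B C₁ C₂ : Type*}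

/-- The regrouping of `A`, `B`, `C = C₁ C₂` into `A C₁` and `B C₂`. -/
def regroup (A B C₁ C₂ : Type*) : A × B × (C₁ × C₂) ≃ (A × C₁) × (B × C₂) where
  toFun x := ((x.1, x.2.2.1), (x.2.1, x.2.2.2))
  invFun y := (y.1.1, y.2.1, (y.1.2, y.2.2))
  left_inv _ := rfl
  right_inv _ := rfl

theorem isBiseparable_tripartiteTensor_iff (α : Matrix (A × C₁) (A × C₁) ℂ)
    (β : Matrix (B × C₂) (B × C₂) ℂ) :
    IsBiseparable (tripartiteTensor α β) ↔
      ∃ (n : ℕ) (ψ : Fin n → (A × C₁) × (B × C₂) → ℂ),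
        (∀ k, IsBiproductKet (ψ k ∘ regroup A B C₁ C₂)) ∧ α ⊗ₖ β = ∑ k, proj (ψ k) := by
  constructor
  · rintro ⟨n, ψ, h1, h2⟩
    refine ⟨n, fun k => ψ k ∘ (regroup A B C₁ C₂).symm, h1, ?_⟩
    ext x y
    have := congrFun (congrFun h2 ((regroup A B C₁ C₂).symm x)) ((regroup A B C₁ C₂).symm y)
    rw [Matrix.sum_apply] at this ⊢
    exact this
  · rintro ⟨n, ψ, h1, h2⟩
    refine ⟨n, fun k => ψ k ∘ regroup A B C₁ C₂, h1, ?_⟩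
    ext x y
    have := congrFun (congrFun h2 (regroup A B C₁ C₂ x)) (regroup A B C₁ C₂ y)
    rw [Matrix.sum_apply] at this ⊢
    exact this

variable [Fintype A] [Fintype B] [Fintype C₁] [Fintype C₂]

theorem posSemidef_tripartiteTensor {α : Matrix (A × C₁) (A × C₁) ℂ}
    {β : Matrix (B × C₂) (B × C₂) ℂ} (hα : α.PosSemidef) (hβ : β.PosSemidef) :
    (tripartiteTensor α β).PosSemidef :=
  (hα.kronecker hβ).submatrix _

/-- Biseparability of `α ⊗ β` is preserved by local operators on `A` and `C₁`. -/
theorem IsBiseparable.kronecker_conj_left {A' C₁' : Type*} {α : Matrix (A × C₁) (A × C₁) ℂ}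
    {β : Matrix (B × C₂) (B × C₂) ℂ} (h : IsBiseparable (tripartiteTensor α β))
    (P : Matrix A' A ℂ) (Q : Matrix C₁' C₁ ℂ) :
    IsBiseparable (tripartiteTensor ((P ⊗ₖ Q) * α * (P ⊗ₖ Q)ᴴ) β) := by
  classical
  rw [isBiseparable_tripartiteTensor_iff] at h ⊢
  obtain ⟨n, ψ, h1, h2⟩ := h
  refine ⟨n, fun k => ((P ⊗ₖ Q) ⊗ₖ (1 : Matrix (B × C₂) (B × C₂) ℂ)) *ᵥ ψ k, fun k => ?_, ?_⟩
  -- The operator acts on each slice `ψ k (·, q)` separately, so each of the three product forms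
  -- survives.
  · have key : ∀ p q, (((P ⊗ₖ Q) ⊗ₖ (1 : Matrix (B × C₂) (B × C₂) ℂ)) *ᵥ ψ k) (p, q) =
        ((P ⊗ₖ Q) *ᵥ fun p => ψ k (p, q)) p := by
      intro p q
      refine (tensorKet_dotProduct (fun p' => (P ⊗ₖ Q) p p')
        (fun q' => (1 : Matrix (B × C₂) (B × C₂) ℂ) q q') (ψ k)).trans ?_
      have : ∀ p', ((fun q' => (1 : Matrix (B × C₂) (B × C₂) ℂ) q q') ⬝ᵥ fun q' => ψ k (p', q')) =
          ψ k (p', q) := fun p' => congrFun (one_mulVec fun q' => ψ k (p', q')) q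
      simp only [this]
      rfl
    rcases h1 k with ⟨u, v, h⟩ | ⟨u, v, h⟩ | ⟨u, v, h⟩
    · refine Or.inl ⟨P *ᵥ u, fun r => (Q *ᵥ fun c => v (r.1, (c, r.2.2))) r.2.1, ?_⟩
      rintro x y ⟨z, z'⟩
      have : (fun p => ψ k (p, (y, z'))) = tensorKet u fun c => v (y, (c, z')) :=
        funext fun p => h p.1 y (p.2, z')
      refine (key (x, z) (y, z')).trans ?_
      rw [this, kronecker_mulVec_tensorKet]
      rfl
    · refine Or.inr (Or.inl ⟨u, fun r =>
        ((P ⊗ₖ Q) *ᵥ fun p => v (p.1, (p.2, r.2.2))) (r.1, r.2.1), ?_⟩)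
      rintro x y ⟨z, z'⟩
      have : (fun p => ψ k (p, (y, z'))) = u y • fun p : A × C₁ => v (p.1, (p.2, z')) :=
        funext fun p => h p.1 y (p.2, z')
      refine (key (x, z) (y, z')).trans ?_
      rw [this, mulVec_smul]
      rfl
    · refine Or.inr (Or.inr ⟨fun r => (Q *ᵥ fun c => u (c, r.2)) r.1,
        fun r => (P *ᵥ fun a => v (a, r.2)) r.1, ?_⟩)
      rintro x y ⟨z, z'⟩
      have : (fun p => ψ k (p, (y, z'))) = tensorKet (fun a => v (a, y)) fun c => u (c, z') :=
        funext fun p => (h p.1 y (p.2, z')).trans (mul_comm _ _)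
      refine (key (x, z) (y, z')).trans ?_
      rw [this, kronecker_mulVec_tensorKet]
      exact mul_comm _ _
  · rw [← mul_sum_proj_mul, ← h2, conjTranspose_kronecker (P ⊗ₖ Q), conjTranspose_one,
      ← mul_kronecker_mul, ← mul_kronecker_mul, Matrix.one_mul, Matrix.mul_one]

variable {α : Matrix (A × C₁) (A × C₁) ℂ} {β : Matrix (B × C₂) (B × C₂) ℂ}

/-- If both `α` and `β` have witnesses, then `α ⊗ β` is not biseparable. -/
theorem HasWitness.not_isBiseparable (hα : HasWitness α) (hβ : HasWitness β) :
    ¬ IsBiseparable (tripartiteTensor α β) := by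
  rw [isBiseparable_tripartiteTensor_iff]
  rintro ⟨n, ψ, h1, h2⟩
  obtain ⟨f, g, hfg, hprod⟩ := hα
  obtain ⟨f', g', hfg', hprod'⟩ := hβ
  have h3 : tensorKet f f' ⬝ᵥ ((α ⊗ₖ β) *ᵥ star (tensorKet g g')) ≠ 0 := by
    have : star (tensorKet g g') = tensorKet (star g) (star g') := by
      ext
      simp [tensorKet]
    rw [this, kronecker_mulVec_tensorKet, tensorKet_dotProduct_tensorKet]
    exact mul_ne_zero hfg hfg'
  refine h3 ?_
  have hmem : ∀ k, ψ k ∈ stateRange (α ⊗ₖ β) := fun k => h2 ▸ mem_stateRange_sum_proj ψ k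
  rw [h2, dotProduct_sum_proj_mulVec]
  refine Finset.sum_eq_zero fun k _ => ?_
  suffices h : tensorKet f f' ⬝ᵥ ψ k = 0 ∨ tensorKet g g' ⬝ᵥ ψ k = 0 by
    rcases h with h | h <;> simp [h]
  -- For the cuts `A|BC` and `C|AB` it suffices that contraction with `f` or with `g` on `A C₁`
  -- annihilates the whole ket.
  have left : ((fun q => f ⬝ᵥ fun p => ψ k (p, q)) = 0 ∨ (fun q => g ⬝ᵥ fun p => ψ k (p, q)) = 0) →
      tensorKet f f' ⬝ᵥ ψ k = 0 ∨ tensorKet g g' ⬝ᵥ ψ k = 0 := by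
    rw [tensorKet_dotProduct, tensorKet_dotProduct, ← dotProduct_contraction_comm,
      ← dotProduct_contraction_comm]
    rintro (h | h)
    · exact Or.inl (by rw [h, dotProduct_zero])
    · exact Or.inr (by rw [h, dotProduct_zero])
  rcases h1 k with ⟨u, v, h⟩ | ⟨u, v, h⟩ | ⟨u, v, h⟩
  · refine left (eq_zero_or_eq_zero_of_forall_dotProduct fun c => ?_)
    rw [dotProduct_contraction_comm, dotProduct_contraction_comm]
    have hm := contraction_mem_left (hmem k) c
    have : (fun p => c ⬝ᵥ fun q => ψ k (p, q)) =
        tensorKet u fun z => c ⬝ᵥ fun q => v (q.1, (z, q.2)) := by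
      ext p
      have : (fun q => ψ k (p, q)) = u p.1 • fun q : B × C₂ => v (q.1, (p.2, q.2)) :=
        funext fun q => h p.1 q.1 (p.2, q.2)
      rw [this, dotProduct_smul]
      rfl
    rw [this] at hm ⊢
    exact hprod _ _ hm
  -- Cut `B|AC`: the roles are exchanged. Any functional on `A C₁` leaves a product ket in the range
  -- of `β`.
  · rw [tensorKet_dotProduct, tensorKet_dotProduct]
    have : (fun p => f' ⬝ᵥ fun q => ψ k (p, q)) = 0 ∨ (fun p => g' ⬝ᵥ fun q => ψ k (p, q)) = 0 := by
      refine eq_zero_or_eq_zero_of_forall_dotProduct fun c => ?_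
      rw [← dotProduct_contraction_comm, ← dotProduct_contraction_comm]
      have hm := contraction_mem_right (hmem k) c
      have : (fun q => c ⬝ᵥ fun p => ψ k (p, q)) =
          tensorKet u fun z => c ⬝ᵥ fun p => v (p.1, (p.2, z)) := by
        ext q
        have : (fun p => ψ k (p, q)) = u q.1 • fun p : A × C₁ => v (p.1, (p.2, q.2)) :=
          funext fun p => h p.1 q.1 (p.2, q.2)
        rw [this, dotProduct_smul]
        rfl
      rw [this] at hm ⊢
      exact hprod' _ _ hm
    rcases this with h | h
    · exact Or.inl (by rw [h, dotProduct_zero])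
    · exact Or.inr (by rw [h, dotProduct_zero])
  -- Cut `C|AB`: the two factors entangle `A` with `B` and `C₁` with `C₂`, so only product
  -- functionals `s ⊗ t` on `B C₂` are sure to leave a product ket of `A` and `C₁`.
  · refine left (eq_zero_or_eq_zero_of_forall_tensorKet fun s t => ?_)
    rw [dotProduct_contraction_comm, dotProduct_contraction_comm]
    have hm := contraction_mem_left (hmem k) (tensorKet s t)
    have : (fun p => tensorKet s t ⬝ᵥ fun q => ψ k (p, q)) =
        tensorKet (fun a => s ⬝ᵥ fun b => v (a, b)) (fun c => t ⬝ᵥ fun c' => u (c, c')) := by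
      ext p
      have : (fun q => ψ k (p, q)) = tensorKet (fun b => v (p.1, b)) (fun c' => u (p.2, c')) :=
        funext fun q => (h p.1 q.1 (p.2, q.2)).trans (mul_comm _ _)
      rw [this, tensorKet_dotProduct_tensorKet]
      rfl
    rw [this] at hm ⊢
    exact hprod _ _ hm

theorem IsSeparable.smul {X Y : Type*} {ρ : Matrix (X × Y) (X × Y) ℂ} (h : IsSeparable ρ) {r : ℝ}
    (hr : 0 ≤ r) : IsSeparable ((r : ℂ) • ρ) := by
  obtain ⟨n, u, v, rfl⟩ := h
  refine ⟨n, fun k => ((√r : ℝ) : ℂ) • u k, v, ?_⟩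
  have hs : ((√r : ℝ) : ℂ) * ((√r : ℝ) : ℂ) = r := by
    rw [← Complex.ofReal_mul, Real.mul_self_sqrt hr]
  rw [Finset.smul_sum]
  refine Finset.sum_congr rfl fun k _ => ?_
  ext x y
  simp only [Matrix.smul_apply, proj, vecMulVec_apply, tensorKet, Pi.star_apply, Pi.smul_apply,
    smul_eq_mul, star_mul', Complex.star_def, Complex.conj_ofReal, ← hs]
  ring

/-- If the range of `α` contains no nonzero product ket, then `α ⊗ β` is not biseparable for any
entangled `β`. -/
theorem not_isBiseparable_of_no_product (hα : IsEntangled α) (hβ : IsEntangled β)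
    (h : ∀ u v, tensorKet u v ∈ stateRange α → tensorKet u v = 0) :
    ¬ IsBiseparable (tripartiteTensor α β) := by
  classical
  rw [isBiseparable_tripartiteTensor_iff]
  rintro ⟨n, ψ, h1, h2⟩
  have hmem : ∀ k, ψ k ∈ stateRange (α ⊗ₖ β) := fun k => h2 ▸ mem_stateRange_sum_proj ψ k
  -- A positive diagonal entry exists because the zero state is separable.
  obtain ⟨r, i, hr, hi⟩ : ∃ (r : ℝ) (i : A × C₁), 0 < r ∧ α i i = r := by
    by_contra! hc
    obtain ⟨w, rfl⟩ := exists_sum_proj hα.1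
    have hw : ∀ k, w k = 0 := by
      intro k
      ext i
      have hz := hc (∑ j, Complex.normSq (w j i)) i
      have he : (∑ k, proj (w k)) i i = ((∑ j, Complex.normSq (w j i) : ℝ) : ℂ) := by
        simp [Matrix.sum_apply, proj, vecMulVec_apply, Complex.mul_conj]
      have h0 : ∑ j, Complex.normSq (w j i) = 0 := by
        refine le_antisymm (not_lt.mp fun hp => hz hp he) ?_
        exact Finset.sum_nonneg fun _ _ => Complex.normSq_nonneg _
      rw [Finset.sum_eq_zero_iff_of_nonneg fun _ _ => Complex.normSq_nonneg _] at h0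
      exact Complex.normSq_eq_zero.mp (h0 k (Finset.mem_univ k))
    refine hα.2 (isSeparable_of_mem_product fun k => ⟨0, 0, ?_⟩)
    rw [hw]
    ext
    simp [tensorKet]
  -- Slices over `B C₂` of kets of the cuts `A|BC` and `C|AB` are product kets in the range of `α`,
  -- hence zero. Only the cut `B|AC` contributes, and its kets restricted to `i` are products of `B`
  -- and `C₂`.
  have hsep : IsSeparable (∑ k, proj fun q => ψ k (i, q)) := by
    refine isSeparable_of_mem_product fun k => ?_
    have hzero : (∀ b c, (fun p => ψ k (p, (b, c))) = 0) →
        ∃ u v, (fun q => ψ k (i, q)) = tensorKet u v := by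
      intro h0
      refine ⟨0, 0, ?_⟩
      ext ⟨b, c⟩
      simpa [tensorKet] using congrFun (h0 b c) i
    have hslice : ∀ q, (fun p => ψ k (p, q)) ∈ stateRange α := by
      intro q
      simpa using contraction_mem_left (hmem k) (Pi.single q 1)
    rcases h1 k with ⟨u, v, hk⟩ | ⟨u, v, hk⟩ | ⟨u, v, hk⟩
    · refine hzero fun b c => ?_
      have : (fun p => ψ k (p, (b, c))) = tensorKet u fun z => v (b, (z, c)) :=
        funext fun p => hk p.1 b (p.2, c)
      rw [this]
      exact h _ _ (this ▸ hslice (b, c))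
    · exact ⟨u, fun z => v (i.1, (i.2, z)), funext fun q => hk i.1 q.1 (i.2, q.2)⟩
    · refine hzero fun b c => ?_
      have : (fun p => ψ k (p, (b, c))) = tensorKet (fun a => v (a, b)) fun z => u (z, c) :=
        funext fun p => (hk p.1 b (p.2, c)).trans (mul_comm _ _)
      rw [this]
      exact h _ _ (this ▸ hslice (b, c))
  -- The block of `α ⊗ β` at `(i, i)` is `r • β`.
  have hβ' : β = ((r⁻¹ : ℝ) : ℂ) • ∑ k, proj fun q => ψ k (i, q) := by
    ext q q'
    have := congrFun (congrFun h2 (i, q)) (i, q')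
    rw [kronecker_apply, hi] at this
    rw [Matrix.smul_apply, Matrix.sum_apply]
    rw [Matrix.sum_apply] at this
    simp only [proj, vecMulVec_apply, Pi.star_apply, smul_eq_mul] at this ⊢
    rw [← this, ← mul_assoc, ← Complex.ofReal_mul, inv_mul_cancel₀ hr.ne', Complex.ofReal_one,
      one_mul]
  exact hβ.2 (hβ' ▸ hsep.smul (inv_nonneg.mpr hr.le))

end Tripartite

/-! ### Local operators with prescribed values on two kets -/

section Transfer

variable {X X' : Type*} [Fintype X]

theorem vecMulVec_mulVec_eq_smul (x : X' → ℂ) (φ z : X → ℂ) :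
    vecMulVec x φ *ᵥ z = (φ ⬝ᵥ z) • x := by
  ext i
  simp only [Matrix.mulVec, dotProduct, vecMulVec_apply, Pi.smul_apply, smul_eq_mul,
    Finset.sum_mul]
  exact Finset.sum_congr rfl fun _ _ => by ring

theorem exists_mulVec_pair {x y : X → ℂ} (h : LinearIndependent ℂ ![x, y]) (x' y' : X' → ℂ) :
    ∃ P : Matrix X' X ℂ, P *ᵥ x = x' ∧ P *ᵥ y = y' := by
  obtain ⟨φ, h1, h2⟩ := exists_dual_pair h
  obtain ⟨φ', h3, h4⟩ := exists_dual_pair (LinearIndependent.pair_symm_iff.mp h)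
  refine ⟨vecMulVec x' φ + vecMulVec y' φ', ?_, ?_⟩ <;>
    simp [add_mulVec, vecMulVec_mulVec_eq_smul, h1, h2, h3, h4]

theorem linearIndependent_basisKet {Y : Type*} [DecidableEq Y] {i j : Y} (h : i ≠ j) :
    LinearIndependent ℂ ![(basisKet i : Y → ℂ), basisKet j] := by
  rw [LinearIndependent.pair_iff]
  intro s t hst
  have h1 := congrFun hst i
  have h2 := congrFun hst j
  simp [basisKet, h, h.symm] at h1 h2
  exact ⟨h1, h2⟩

end Transfer

/-! ### States in the space spanned by the kets `|a_i, i⟩` -/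

section EntanglementBreaking

theorem exists_coeff_of_mem_ebSpace {X Y : Type*} [DecidableEq Y] {a : Y → X → ℂ}
    {w : X × Y → ℂ} (hw : w ∈ ebSpace a) : ∃ c : Y → ℂ, ∀ x y, w (x, y) = a y x * c y := by
  refine Submodule.span_induction ?_ ?_ ?_ ?_ hw
  · rintro _ ⟨i, rfl⟩
    refine ⟨basisKet i, fun x y => ?_⟩
    by_cases h : y = i
    · subst h; rfl
    · simp [tensorKet, basisKet, h]
  · exact ⟨0, by simp⟩
  · rintro f g - - ⟨c, hc⟩ ⟨e, he⟩
    exact ⟨c + e, fun x y => by simp [hc, he, mul_add]⟩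
  · rintro t f - ⟨c, hc⟩
    exact ⟨t • c, fun x y => by simp [hc]; ring⟩

/-- A state in `ebSpace a` without coherence between labels `i`, `j` with independent `a i`, `a j`
is separable. -/
theorem isSeparable_of_no_coherence {X Y ι : Type*} [Fintype Y] [Fintype ι] (a : Y → X → ℂ)
    (c : ι → Y → ℂ)
    (h : ∀ i j, LinearIndependent ℂ ![a i, a j] → ∑ k, c k i * star (c k j) = 0) :
    IsSeparable (∑ k, proj fun p : X × Y => a p.2 p.1 * c k p.2) := by
  classical
  -- Labels are grouped by the line that `a i` spans. Coherence survives only inside a group, where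
  -- all `a i` are multiples of one vector, so each group contributes product kets.
  let r : Setoid Y := Setoid.ker fun i => Submodule.span ℂ {a i}
  let rep : Y → Y := fun i => (Quotient.mk r i).out
  have hrep : ∀ i, ∃ t : ℂ, t • a (rep i) = a i := by
    intro i
    have : Submodule.span ℂ {a (rep i)} = Submodule.span ℂ {a i} := Quotient.mk_out (s := r) i
    exact Submodule.mem_span_singleton.mp (this ▸ Submodule.mem_span_singleton_self (a i))
  choose t ht using hrep
  have hout : ∀ i j, rep i ≠ rep j → ∀ x x',
      a i x * star (a j x') * ∑ k, c k i * star (c k j) = 0 := by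
    intro i j hij x x'
    by_cases hi : a i = 0
    · simp [hi]
    by_cases hj : a j = 0
    · simp [hj]
    rw [h i j, mul_zero]
    by_contra hli
    obtain ⟨s, hs⟩ := exists_smul_of_not_linearIndependent hi hli
    have hs0 : s ≠ 0 := by
      rintro rfl
      exact hj (by rw [← hs, zero_smul])
    refine hij (congrArg Quotient.out (Quotient.sound (s := r) ?_))
    change Submodule.span ℂ {a i} = Submodule.span ℂ {a j}
    rw [← hs, Submodule.span_singleton_smul_eq hs0.isUnit]
  -- Each ket is cut into its group components. A label `q.1` that is not a chosen representative
  -- contributes the zero ket.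
  have : ∑ k, proj (fun p : X × Y => a p.2 p.1 * c k p.2) =
      ∑ q : Y × ι, proj (tensorKet (a q.1) fun i => if rep i = q.1 then c q.2 i * t i else 0) := by
    ext ⟨x, i⟩ ⟨x', j⟩
    simp only [Matrix.sum_apply, Fintype.sum_prod_type, proj, vecMulVec_apply, Pi.star_apply,
      tensorKet]
    rw [Finset.sum_eq_single (rep i)]
    · by_cases hij : rep i = rep j
      · refine Finset.sum_congr rfl fun k _ => ?_
        rw [if_pos rfl, if_pos hij.symm, ← ht i, ← ht j, hij]
        simp only [Pi.smul_apply, smul_eq_mul]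
        congr 1
        · ring
        · congr 1; ring
      · have h0 := hout i j hij x x'
        rw [Finset.mul_sum] at h0
        rw [Finset.sum_eq_zero (s := Finset.univ) (f := fun k => a (rep i) x * _ * _)]
        · rw [← h0]
          refine Finset.sum_congr rfl fun k _ => ?_
          simp only [star_mul']
          ring
        · intro k _
          rw [if_neg (Ne.symm hij)]
          simp
    · intro l _ hl
      refine Finset.sum_eq_zero fun k _ => ?_
      rw [if_neg hl.symm]
      simp
    · simp
  rw [this]
  exact isSeparable_sum_proj _ _

variable {X Y : Type*} [Fintype X] [Fintype Y]

/-- An entangled state in the space `ebSpace a` can be locally projected onto a two-qubit state in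
the span of `|1, 1⟩` and `|2, 2⟩` with a nonzero off-diagonal entry. -/
theorem exists_projection_twoKetSpace [DecidableEq Y] {a : Y → X → ℂ}
    {α : Matrix (X × Y) (X × Y) ℂ} (hα : IsEntangled α) (hr : stateRange α ≤ ebSpace a) :
    ∃ i j, LinearIndependent ℂ ![a i, a j] ∧
      ∃ (P : Matrix (Fin (0 + 2)) X ℂ) (Q : Matrix (Fin (0 + 2)) Y ℂ),
        stateRange ((P ⊗ₖ Q) * α * (P ⊗ₖ Q)ᴴ) ≤ twoKetSpace 0 0 ∧
          ((P ⊗ₖ Q) * α * (P ⊗ₖ Q)ᴴ) (0, 0) (1, 1) ≠ 0 := by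
  obtain ⟨hp, hs⟩ := hα
  obtain ⟨w, rfl⟩ := exists_sum_proj hp
  choose c hc using fun k => exists_coeff_of_mem_ebSpace (hr (mem_stateRange_sum_proj w k))
  have hw : w = fun k p => a p.2 p.1 * c k p.2 := funext fun k => funext fun p => hc k p.1 p.2
  obtain ⟨i, j, hij, hne⟩ : ∃ i j, LinearIndependent ℂ ![a i, a j] ∧
      ∑ k, c k i * star (c k j) ≠ 0 := by
    by_contra! hcon
    refine hs ?_
    rw [hw]
    exact isSeparable_of_no_coherence a c hcon
  refine ⟨i, j, hij, ?_⟩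
  have hne' : i ≠ j := by
    rintro rfl
    have := LinearIndependent.pair_iff.mp hij 1 (-1) (by simp)
    exact one_ne_zero this.1
  obtain ⟨P, hP1, hP2⟩ := exists_mulVec_pair hij (basisKet 0) (basisKet 1 : Fin (0 + 2) → ℂ)
  -- `Q` discards all labels except `i` and `j`, so the values of `P` on the other vectors `a y` do
  -- not matter.
  let Q : Matrix (Fin (0 + 2)) Y ℂ :=
    vecMulVec (basisKet 0) (basisKet i) + vecMulVec (basisKet 1) (basisKet j)
  have hsum : ∀ k, w k = ∑ y, c k y • tensorKet (a y) (basisKet y) := by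
    intro k
    ext ⟨x, y⟩
    simp [hc, tensorKet, basisKet, Pi.single_apply, mul_comm]
  have hQ : ∀ y, Q *ᵥ basisKet y =
      (if y = i then basisKet 0 else 0) + (if y = j then basisKet 1 else 0) := by
    intro y
    simp only [Q, add_mulVec, vecMulVec_mulVec_eq_smul, basisKet, single_one_dotProduct]
    simp only [Pi.single_apply, ite_smul, one_smul, zero_smul, eq_comm]
  have hK : ∀ k, (P ⊗ₖ Q) *ᵥ w k = c k i • tensorKet (basisKet 0) (basisKet 0) +
      c k j • tensorKet (basisKet 1) (basisKet 1) := by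
    intro k
    have hadd : ∀ (u : Fin (0 + 2) → ℂ) (v v' : Fin (0 + 2) → ℂ),
        tensorKet u (v + v') = tensorKet u v + tensorKet u v' := fun u v v' => by
      ext; simp [tensorKet, mul_add]
    have hite : ∀ (u v : Fin (0 + 2) → ℂ) (b : Prop) [Decidable b],
        tensorKet u (if b then v else 0) = if b then tensorKet u v else 0 := fun u v b _ => by
      split_ifs
      · rfl
      · ext; simp [tensorKet]
    rw [hsum, mulVec_sum]
    simp only [mulVec_smul, kronecker_mulVec_tensorKet, hQ, hadd, hite, smul_add, smul_ite,
      smul_zero, Finset.sum_add_distrib, Finset.sum_ite_eq', Finset.mem_univ, if_true, hP1, hP2]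
  refine ⟨P, Q, ?_, ?_⟩
  · rw [mul_sum_proj_mul, stateRange_sum_proj, Submodule.span_le]
    rintro _ ⟨k, rfl⟩
    exact Submodule.mem_span_pair.mpr ⟨c k i, c k j, (hK k).symm⟩
  · rw [mul_sum_proj_mul]
    simp only [hK, Matrix.sum_apply, proj, vecMulVec_apply]
    simpa [tensorKet, basisKet] using hne

theorem twoKetSpace_coords {m n : ℕ} {w : Fin (m + 2) × Fin (n + 2) → ℂ}
    (h : w ∈ twoKetSpace m n) :
    w (0, 0) • tensorKet (basisKet 0) (basisKet 0) +
      w (1, 1) • tensorKet (basisKet 1) (basisKet 1) = w := by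
  obtain ⟨s, t, rfl⟩ := Submodule.mem_span_pair.mp h
  simp [tensorKet, basisKet]

theorem HasWitness.of_twoKetSpace {m n : ℕ}
    {σ : Matrix (Fin (m + 2) × Fin (n + 2)) (Fin (m + 2) × Fin (n + 2)) ℂ}
    (hr : stateRange σ ≤ twoKetSpace m n) (hne : σ (0, 0) (1, 1) ≠ 0) : HasWitness σ := by
  refine .of_dual_pair (f := Pi.single (0, 0) 1) (g := Pi.single (1, 1) 1) hr
    (linearIndependent_basisKet (by simp)) (linearIndependent_basisKet (by simp)) ?_ ?_ ?_
  · simp [tensorKet, basisKet]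
  · simp [tensorKet, basisKet]
  · have : star (Pi.single (1, 1) 1 : Fin (m + 2) × Fin (n + 2) → ℂ) = Pi.single (1, 1) 1 := by
      ext p
      simp [Pi.single_apply, apply_ite]
    rw [this, mulVec_single_one, single_one_dotProduct]
    exact hne

theorem HasWitness.of_stateRange_le_ebSpace [DecidableEq Y] {a : Y → X → ℂ}
    {α : Matrix (X × Y) (X × Y) ℂ} (hα : IsEntangled α) (hr : stateRange α ≤ ebSpace a) :
    HasWitness α := by
  obtain ⟨i, j, -, P, Q, h1, h2⟩ := exists_projection_twoKetSpace hα hr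
  exact (HasWitness.of_twoKetSpace h1 h2).of_kronecker_conj hα.1 P Q

theorem HasWitness.of_projectsOntoRankLETwo {α : Matrix (X × Y) (X × Y) ℂ} (hα : α.PosSemidef)
    (h : ProjectsOntoRankLETwo α) : HasWitness α := by
  obtain ⟨m, n, σ, ⟨P, Q, hσ⟩, hent, hrank⟩ := h
  rw [← conjTranspose_kronecker] at hσ
  subst hσ
  exact (HasWitness.of_rank_le_two hent (by omega)).of_kronecker_conj hα P Q

/-- A state in the span of `|1, 1⟩` and `|2, 2⟩` with a nonzero off-diagonal entry either has this
space as its range or has no nonzero product ket in its range. -/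
theorem stateRange_eq_twoKetSpace_or_no_product {m n : ℕ}
    {σ : Matrix (Fin (m + 2) × Fin (n + 2)) (Fin (m + 2) × Fin (n + 2)) ℂ} (hσ : σ.PosSemidef)
    (hr : stateRange σ ≤ twoKetSpace m n) (hne : σ (0, 0) (1, 1) ≠ 0) :
    stateRange σ = twoKetSpace m n ∨ ∀ u v, tensorKet u v ∈ stateRange σ → tensorKet u v = 0 := by
  rw [or_iff_not_imp_right]
  intro hprod
  push Not at hprod
  obtain ⟨u, v, hmem, h0⟩ := hprod
  have hne' : σ (1, 1) (0, 0) ≠ 0 := by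
    rw [← hσ.isHermitian.apply]
    simpa using hne
  have hcol : ∀ p, (fun q => σ q p) ∈ stateRange σ := fun p =>
    ⟨Pi.single p 1, by rw [Matrix.mulVecLin_apply, mulVec_single_one]; rfl⟩
  have hsmul : ∀ (s : ℂ) (x : Fin (m + 2) × Fin (n + 2) → ℂ), s ≠ 0 →
      s • x ∈ stateRange σ → x ∈ stateRange σ := fun s x hs hx =>
    (Submodule.smul_mem_iff _ hs).mp hx
  have hu := twoKetSpace_coords (hr hmem)
  have c0 := twoKetSpace_coords (hr (hcol (0, 0)))
  have c1 := twoKetSpace_coords (hr (hcol (1, 1)))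
  have hli {k : ℕ} : LinearIndependent ℂ ![(basisKet 0 : Fin (k + 2) → ℂ), basisKet 1] :=
    linearIndependent_basisKet (by simp)
  suffices h : tensorKet (basisKet 0) (basisKet 0) ∈ stateRange σ ∧
      tensorKet (basisKet 1) (basisKet 1) ∈ stateRange σ by
    refine le_antisymm hr ?_
    rw [twoKetSpace, Submodule.span_le]
    rintro _ (rfl | rfl)
    exacts [h.1, h.2]
  -- A nonzero product ket in the range is a multiple of `|1,1⟩` or `|2,2⟩`. The column of `σ`
  -- indexed by that same label lies in the range and has a nonzero off-diagonal entry, so it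
  -- supplies the other ket.
  rcases mul_eq_zero_of_add_product hli hli hu with hz | hz
  · have h1 : tensorKet (basisKet 1) (basisKet 1) ∈ stateRange σ := by
      rw [hz, zero_smul, zero_add] at hu
      refine hsmul (tensorKet u v (1, 1)) _ (fun h => h0 ?_) (by rw [hu]; exact hmem)
      rw [← hu, h, zero_smul]
    refine ⟨hsmul _ _ hne ?_, h1⟩
    have := Submodule.sub_mem _ (hcol (1, 1)) (Submodule.smul_mem _ (σ (1, 1) (1, 1)) h1)
    rwa [← c1, add_sub_cancel_right] at this
  · have h1 : tensorKet (basisKet 0) (basisKet 0) ∈ stateRange σ := by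
      rw [hz, zero_smul, add_zero] at hu
      refine hsmul (tensorKet u v (0, 0)) _ (fun h => h0 ?_) (by rw [hu]; exact hmem)
      rw [← hu, h, zero_smul]
    refine ⟨h1, hsmul _ _ hne' ?_⟩
    have := Submodule.sub_mem _ (hcol (0, 0)) (Submodule.smul_mem _ (σ (0, 0) (0, 0)) h1)
    rwa [← c0, add_sub_cancel_left] at this

/-- A state in the span of `|1, 1⟩` and `|2, 2⟩` is locally equivalent to a state in `ebSpace a` as
soon as two of the vectors `a i` are independent. -/
theorem exists_embedding_ebSpace [DecidableEq Y] {a : Y → X → ℂ} {i j : Y}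
    (hij : LinearIndependent ℂ ![a i, a j]) {m n : ℕ}
    {γ : Matrix (Fin (m + 2) × Fin (n + 2)) (Fin (m + 2) × Fin (n + 2)) ℂ} (hγ : γ.PosSemidef)
    (hr : stateRange γ ≤ twoKetSpace m n) :
    ∃ (P' : Matrix X (Fin (m + 2)) ℂ) (Q' : Matrix Y (Fin (n + 2)) ℂ)
      (P : Matrix (Fin (m + 2)) X ℂ) (Q : Matrix (Fin (n + 2)) Y ℂ),
      stateRange ((P' ⊗ₖ Q') * γ * (P' ⊗ₖ Q')ᴴ) ≤ ebSpace a ∧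
        (P ⊗ₖ Q) * ((P' ⊗ₖ Q') * γ * (P' ⊗ₖ Q')ᴴ) * (P ⊗ₖ Q)ᴴ = γ := by
  have hne : i ≠ j := by
    rintro rfl
    have := LinearIndependent.pair_iff.mp hij 1 (-1) (by simp)
    exact one_ne_zero this.1
  have hli {k : ℕ} : LinearIndependent ℂ ![(basisKet 0 : Fin (k + 2) → ℂ), basisKet 1] :=
    linearIndependent_basisKet (by simp)
  -- `P` and `Q` undo `P'` and `Q'` on the kets that occur in `γ`; they need not be inverses
  -- elsewhere.
  obtain ⟨P, hP1, hP2⟩ := exists_mulVec_pair hij (basisKet 0 : Fin (m + 2) → ℂ) (basisKet 1)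
  obtain ⟨Q, hQ1, hQ2⟩ := exists_mulVec_pair (linearIndependent_basisKet hne)
    (basisKet 0 : Fin (n + 2) → ℂ) (basisKet 1)
  obtain ⟨P', hP1', hP2'⟩ := exists_mulVec_pair (hli (k := m)) (a i) (a j)
  obtain ⟨Q', hQ1', hQ2'⟩ := exists_mulVec_pair (hli (k := n)) (basisKet i : Y → ℂ) (basisKet j)
  obtain ⟨w, rfl⟩ := exists_sum_proj hγ
  have hw := fun k => twoKetSpace_coords (hr (mem_stateRange_sum_proj w k))
  have hK : ∀ k, (P' ⊗ₖ Q') *ᵥ w k = w k (0, 0) • tensorKet (a i) (basisKet i) +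
      w k (1, 1) • tensorKet (a j) (basisKet j) := by
    intro k
    conv_lhs => rw [← hw k]
    simp only [mulVec_add, mulVec_smul, kronecker_mulVec_tensorKet, hP1', hP2', hQ1', hQ2']
  refine ⟨P', Q', P, Q, ?_, ?_⟩ <;> rw [mul_sum_proj_mul]
  · rw [stateRange_sum_proj, Submodule.span_le]
    rintro _ ⟨k, rfl⟩
    simp only [hK]
    exact Submodule.add_mem _ (Submodule.smul_mem _ _ (Submodule.subset_span ⟨i, rfl⟩))
      (Submodule.smul_mem _ _ (Submodule.subset_span ⟨j, rfl⟩))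
  · rw [mul_sum_proj_mul]
    refine Finset.sum_congr rfl fun k _ => ?_
    rw [hK, mulVec_add, mulVec_smul, mulVec_smul, kronecker_mulVec_tensorKet,
      kronecker_mulVec_tensorKet, hP1, hP2, hQ1, hQ2, hw]

end EntanglementBreaking

/-! ### Reduction to states with range `span {|1,1⟩, |2,2⟩}` -/

section Equivalence

variable {X Y B C₂ : Type*} [Fintype X] [Fintype Y] [Fintype B] [Fintype C₂] [DecidableEq Y]

/-- For a fixed entangled `β`, the genuine entanglement of `α ⊗ β` for all entangled `α` in a space
`ebSpace a` is equivalent to that for all entangled states with range spanned by `|1, 1⟩` and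
`|2, 2⟩`. -/
theorem forall_isGenuinelyEntangled_iff {a : Y → X → ℂ}
    (ha : ∃ α : Matrix (X × Y) (X × Y) ℂ, IsEntangled α ∧ stateRange α ≤ ebSpace a)
    {β : Matrix (B × C₂) (B × C₂) ℂ} (hβ : IsEntangled β) :
    (∀ α : Matrix (X × Y) (X × Y) ℂ, IsEntangled α → stateRange α ≤ ebSpace a →
        IsGenuinelyEntangled (tripartiteTensor α β)) ↔
      ∀ (m n : ℕ) (γ : Matrix (Fin (m + 2) × Fin (n + 2)) (Fin (m + 2) × Fin (n + 2)) ℂ),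
        IsEntangled γ → stateRange γ = twoKetSpace m n →
        IsGenuinelyEntangled (tripartiteTensor γ β) := by
  constructor
  · intro H m n γ hγ hr
    obtain ⟨α₀, hα₀, hr₀⟩ := ha
    -- The given entangled state serves only to supply two independent vectors `a i`, `a j`.
    obtain ⟨i, j, hij, -⟩ := exists_projection_twoKetSpace hα₀ hr₀
    obtain ⟨P', Q', P, Q, hαr, hαγ⟩ := exists_embedding_ebSpace hij hγ.1 hr.le
    refine ⟨posSemidef_tripartiteTensor hγ.1 hβ.1, fun hb => ?_⟩
    refine (H _ ⟨hγ.1.mul_mul_conjTranspose_same _, fun hs => hγ.2 ?_⟩ hαr).2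
      (hb.kronecker_conj_left P' Q')
    exact hαγ ▸ hs.kronecker_conj P Q
  · intro H α hα hr
    refine ⟨posSemidef_tripartiteTensor hα.1 hβ.1, fun hb => ?_⟩
    obtain ⟨i, j, -, P, Q, h1, h2⟩ := exists_projection_twoKetSpace hα hr
    have hb' := hb.kronecker_conj_left P Q
    have hσ : IsEntangled ((P ⊗ₖ Q) * α * (P ⊗ₖ Q)ᴴ) :=
      ⟨hα.1.mul_mul_conjTranspose_same _, (HasWitness.of_twoKetSpace h1 h2).not_isSeparable⟩
    -- The hypothesis covers only states whose range is the full span; the other alternative needs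
    -- no assumption on `β` beyond entanglement.
    rcases stateRange_eq_twoKetSpace_or_no_product hσ.1 h1 h2 with h | h
    · exact (H 0 0 _ hσ h).2 hb'
    · exact not_isBiseparable_of_no_product hσ hβ h hb'

end Equivalence

end GEState

theorem theorem1 :
    -- (i) and (ii)
    (∀ (dA dB dC₁ dC₂ : ℕ)
      (α : Matrix (Fin dA × Fin dC₁) (Fin dA × Fin dC₁) ℂ)
      (β : Matrix (Fin dB × Fin dC₂) (Fin dB × Fin dC₂) ℂ),
      GEState.IsEntangled α → GEState.IsEntangled β →
      ((GEState.ProjectsOntoRankLETwo α ∧ GEState.ProjectsOntoRankLETwo β) ∨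
        (∃ (a : Fin dC₁ → Fin dA → ℂ) (b : Fin dC₂ → Fin dB → ℂ),
          GEState.stateRange α ≤ GEState.ebSpace a ∧ GEState.stateRange β ≤ GEState.ebSpace b)) →
      GEState.IsGenuinelyEntangled (GEState.tripartiteTensor α β)) ∧
    -- (iii)
    (∀ (dA dC₁ : ℕ) (a : Fin dC₁ → Fin dA → ℂ),
      (∃ α : Matrix (Fin dA × Fin dC₁) (Fin dA × Fin dC₁) ℂ,
        GEState.IsEntangled α ∧ GEState.stateRange α ≤ GEState.ebSpace a) →
      -- the equivalence of the two statements about all `β`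
      ((∀ α : Matrix (Fin dA × Fin dC₁) (Fin dA × Fin dC₁) ℂ,
          GEState.IsEntangled α → GEState.stateRange α ≤ GEState.ebSpace a →
          ∀ (dB dC₂ : ℕ) (β : Matrix (Fin dB × Fin dC₂) (Fin dB × Fin dC₂) ℂ),
            GEState.IsEntangled β →
            GEState.IsGenuinelyEntangled (GEState.tripartiteTensor α β)) ↔
        (∀ (m n : ℕ) (γ : Matrix (Fin (m + 2) × Fin (n + 2)) (Fin (m + 2) × Fin (n + 2)) ℂ),
          GEState.IsEntangled γ → GEState.stateRange γ = GEState.twoKetSpace m n →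
          ∀ (dB dC₂ : ℕ) (β : Matrix (Fin dB × Fin dC₂) (Fin dB × Fin dC₂) ℂ),
            GEState.IsEntangled β →
            GEState.IsGenuinelyEntangled (GEState.tripartiteTensor γ β))) ∧
      -- and the same equivalence for each single `β`
      (∀ (dB dC₂ : ℕ) (β : Matrix (Fin dB × Fin dC₂) (Fin dB × Fin dC₂) ℂ),
        GEState.IsEntangled β →
        ((∀ α : Matrix (Fin dA × Fin dC₁) (Fin dA × Fin dC₁) ℂ,
            GEState.IsEntangled α → GEState.stateRange α ≤ GEState.ebSpace a →
            GEState.IsGenuinelyEntangled (GEState.tripartiteTensor α β)) ↔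
          (∀ (m n : ℕ) (γ : Matrix (Fin (m + 2) × Fin (n + 2)) (Fin (m + 2) × Fin (n + 2)) ℂ),
            GEState.IsEntangled γ → GEState.stateRange γ = GEState.twoKetSpace m n →
            GEState.IsGenuinelyEntangled (GEState.tripartiteTensor γ β))))) := by
  refine ⟨fun dA dB dC₁ dC₂ α β hα hβ h =>
    ⟨GEState.posSemidef_tripartiteTensor hα.1 hβ.1, ?_⟩, fun dA dC₁ a ha =>
    ⟨⟨fun H m n γ hγ hr dB dC₂ β hβ => ?_, fun H α hα hr dB dC₂ β hβ => ?_⟩,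
      fun dB dC₂ β hβ => GEState.forall_isGenuinelyEntangled_iff ha hβ⟩⟩
  · rcases h with ⟨h1, h2⟩ | ⟨a, b, h1, h2⟩
    · exact (GEState.HasWitness.of_projectsOntoRankLETwo hα.1 h1).not_isBiseparable
        (.of_projectsOntoRankLETwo hβ.1 h2)
    · exact (GEState.HasWitness.of_stateRange_le_ebSpace hα h1).not_isBiseparable
        (.of_stateRange_le_ebSpace hβ h2)
  · exact (GEState.forall_isGenuinelyEntangled_iff ha hβ).mp
      (fun α hα hr => H α hα hr dB dC₂ β hβ) m n γ hγ hr
  · exact (GEState.forall_isGenuinelyEntangled_iff ha hβ).mpr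
      (fun m n γ hγ hr => H m n γ hγ hr dB dC₂ β hβ) α hα hr
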